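/- Let \(\mathcal G\) be a connected undirected graph on \(\{1,\dots,N\}\), and write \(\mathcal N_i\) for the set consisting of \(i\) and its neighbours. Let \(A=(a_{ij})\), \(\tilde A=(\tilde a_{ij})\in\mathbb R^{N\times N}\) satisfy \(a_{ij},\tilde a_{ij}>0\) for \(j\in\mathcal N_i\) and \(a_{ij}=\tilde a_{ij}=0\) otherwise, with \(A\mathbf 1=\mathbf 1\) and \(\mathbf 1^\top\tilde A=\mathbf 1^\top\). Let \(C_1,\dots,C_N\in\mathbb R^{d\times d}\) be symmetric positive definite. Put \(\mathbf A=A\otimes I_d\), \(\tilde{\mathbf A}=\tilde A\otimes I_d\), \(\mathbf I=\mathbf 1_N\otimes I_d\), \(C=\mathrm{diag}(C_1,\dots,C_N)\). For \(\Gamma_1,\dots,\Gamma_N\in\mathbb R^{d\times p}\) put \(Q=\mathrm{col}(-C_1\Gamma_1,\dots,-C_N\Gamma_N)\) and \(\Sigma=(\sum_i C_i)^{-1}\sum_i C_i\Gamma_i\), and for \(\theta_0\in\mathbb R^p\) put \(\theta^\star=\Sigma\theta_0\). With gains \(K_z,K_y\in\mathbb R^{Nd\times Nd}\), the closed-loop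 gradient-tracking system is \(w^+=Fw+G\theta_0\) with state \(w=(x,z)\), \(x=(x_1,\dots,x_N)\), \(z=(z_1,\dots,z_N)\), \(x_i,z_i\in\mathbb R^d\), and \[F=\begin{bmatrix}\mathbf A+K_yC&K_z\\(\tilde{\mathbf A}-I)C&\tilde{\mathbf A}\end{bmatrix},\qquad G=\begin{bmatrix}K_yQ\\(\tilde{\mathbf A}-I)Q\end{bmatrix}.\] Let \(\mathcal V\subset\mathbb R^{2Nd}\) be the reachable subspace of the pair \((F_0,B_0)\), where \(F_0\) is \(F\) with \(K_y=K_z=0\) and \(B_0=\begin{bmatrix}I\\0\end{bmatrix}\). Call \(P\in\mathbb R^{2Nd\times p}\) admissible if \(\operatorname{Im}P\subset\mathcal V^\perp\) and there is \(\Pi\in\mathbb R^{2Nd\times p}\) with \(\Pi=F\Pi+G\), \([\,I\ \ 0\,]\,\Pi=\mathbf I\Sigma\), and \(u^\top(\Pi-P)=0\) for all \(u\in\mathcal V^\perp\). Then there is \(\gamma^\star>0\), depending only on \(A,\tilde A,C_1,\dots,C_N\), such that for all \(p\) and \(\Gamma_1,\dots,\Gamma_N\), and for every diagonal positive definite \(\Lambda\in\mathbb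 R^{Nd\times Nd}\) all of whose eigenvalues lie in \((0,\gamma^\star)\), the following holds with \(K_z=K_y=-\Lambda\): an admissible \(P\) exists, and for every admissible \(P\) and every \(\theta_0\in\mathbb R^p\), each trajectory of the closed-loop system with \((x(0),z(0))\in\mathcal O=P\theta_0+\mathcal V\) is bounded and satisfies \(\lim_{t\to\infty}x_i(t)=\theta^\star\) for every \(i\). In particular, this holds for \(\Lambda=\gamma I\) with any \(\gamma\in(0,\gamma^\star)\). -/

import Mathlib

open Matrix Filter Topology
open scoped Kronecker

namespace GradientTracking

/-! ### Network -/

/-- `A` matches the graph `G` on the agents: its entry `(i, j)` is positive when `j` is a neighbour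
of `i`, and zero otherwise. Every agent is a neighbour of itself. -/
def Matches {N : ℕ} (G : SimpleGraph (Fin N)) (A : Matrix (Fin N) (Fin N) ℝ) : Prop :=
  ∀ i j, ((i = j ∨ G.Adj i j) → 0 < A i j) ∧ (¬ (i = j ∨ G.Adj i j) → A i j = 0)

/-- The entries of each row sum to one. -/
def RowStochastic {N : ℕ} (A : Matrix (Fin N) (Fin N) ℝ) : Prop :=
  A *ᵥ (fun _ => 1) = fun _ => 1

/-- The entries of each column sum to one. -/
def ColStochastic {N : ℕ} (A : Matrix (Fin N) (Fin N) ℝ) : Prop :=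
  (fun _ => 1) ᵥ* A = fun _ => 1

/-! ### The quadratic problem

The cost of agent `i` is `f_i θ = (1/2) (θ - Γ_i θ₀)ᵀ C_i (θ - Γ_i θ₀)`.
Stacked vectors in `ℝ^{N d}` are indexed by `Fin N × Fin d`. -/

/-- The matrix `Σ = (∑ C_i)⁻¹ ∑ C_i Γ_i`. -/
noncomputable def optMap {N d p : ℕ} (C : Fin N → Matrix (Fin d) (Fin d) ℝ)
    (Γ : Fin N → Matrix (Fin d) (Fin p) ℝ) : Matrix (Fin d) (Fin p) ℝ :=
  (∑ i, C i)⁻¹ * ∑ i, C i * Γ i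

/-- The block-diagonal matrix `diag(C_1, …, C_N)`. -/
def stackC {N d : ℕ} (C : Fin N → Matrix (Fin d) (Fin d) ℝ) :
    Matrix (Fin N × Fin d) (Fin N × Fin d) ℝ :=
  Matrix.of fun a b => if a.1 = b.1 then C a.1 a.2 b.2 else 0

/-- The matrix `col(Q_1, …, Q_N)`, where `Q_i = -C_i Γ_i`, so that the stacked local gradients at
`x = (x_1, …, x_N)` are `y = C x + Q θ₀`. -/
def stackQ {N d p : ℕ} (C : Fin N → Matrix (Fin d) (Fin d) ℝ)
    (Γ : Fin N → Matrix (Fin d) (Fin p) ℝ) : Matrix (Fin N × Fin d) (Fin p) ℝ :=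
  Matrix.of fun a k => (-(C a.1 * Γ a.1)) a.2 k

/-- The matrix `𝐈 = 1_N ⊗ I_d`. -/
def consensus (N d : ℕ) : Matrix (Fin N × Fin d) (Fin d) ℝ :=
  Matrix.of fun a k => if a.2 = k then 1 else 0

/-- The matrix `A ⊗ I_d`. -/
def lift {N : ℕ} (d : ℕ) (A : Matrix (Fin N) (Fin N) ℝ) :
    Matrix (Fin N × Fin d) (Fin N × Fin d) ℝ :=
  A ⊗ₖ (1 : Matrix (Fin d) (Fin d) ℝ)

/-! ### Linear dynamic controllers and the set-point control problem -/

/-- A linear controller `z⁺ = Φ z + Bx x + By y`, `u = Kz z + Kx x + Ky y` for the plant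
`x⁺ = u`, `y = C x + Q θ₀`, with `x ∈ ℝ^{N d}` and `z ∈ ℝ^{N nz}`. -/
structure Controller (N d nz : ℕ) where
  Φ : Matrix (Fin N × Fin nz) (Fin N × Fin nz) ℝ
  Bx : Matrix (Fin N × Fin nz) (Fin N × Fin d) ℝ
  By : Matrix (Fin N × Fin nz) (Fin N × Fin d) ℝ
  Kz : Matrix (Fin N × Fin d) (Fin N × Fin nz) ℝ
  Kx : Matrix (Fin N × Fin d) (Fin N × Fin d) ℝ
  Ky : Matrix (Fin N × Fin d) (Fin N × Fin d) ℝ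

/-- Index type of the closed-loop state `(x, z)`. -/
abbrev Idx (N d nz : ℕ) : Type := (Fin N × Fin d) ⊕ (Fin N × Fin nz)

/-- The closed-loop matrix `F`. -/
def Controller.F {N d nz : ℕ} (K : Controller N d nz) (C : Fin N → Matrix (Fin d) (Fin d) ℝ) :
    Matrix (Idx N d nz) (Idx N d nz) ℝ :=
  Matrix.fromBlocks (K.Kx + K.Ky * stackC C) K.Kz (K.Bx + K.By * stackC C) K.Φ

/-- The closed-loop input matrix `G`. -/
def Controller.G {N d nz p : ℕ} (K : Controller N d nz) (C : Fin N → Matrix (Fin d) (Fin d) ℝ)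
    (Γ : Fin N → Matrix (Fin d) (Fin p) ℝ) : Matrix (Idx N d nz) (Fin p) ℝ :=
  Matrix.fromRows (K.Ky * stackQ C Γ) (K.By * stackQ C Γ)

/-- `w = (x, z)` is a trajectory of the closed-loop system `w⁺ = F w + G θ₀`. -/
def Controller.IsTrajectory {N d nz p : ℕ} (K : Controller N d nz)
    (C : Fin N → Matrix (Fin d) (Fin d) ℝ) (Γ : Fin N → Matrix (Fin d) (Fin p) ℝ)
    (θ₀ : Fin p → ℝ) (w : ℕ → Idx N d nz → ℝ) : Prop :=
  ∀ t, w (t + 1) = K.F C *ᵥ w t + K.G C Γ *ᵥ θ₀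

/-- The controller solves the set-point control problem from the initialization set `O θ₀`:
for every `θ₀`, every closed-loop trajectory starting in `O θ₀` is bounded, and each `x_i`
converges to `θ⋆ = Σ θ₀`. -/
def Controller.SolvesFrom {N d nz p : ℕ} (K : Controller N d nz)
    (C : Fin N → Matrix (Fin d) (Fin d) ℝ) (Γ : Fin N → Matrix (Fin d) (Fin p) ℝ)
    (O : (Fin p → ℝ) → Set (Idx N d nz → ℝ)) : Prop :=
  ∀ (θ₀ : Fin p → ℝ) (w : ℕ → Idx N d nz → ℝ), K.IsTrajectory C Γ θ₀ w → w 0 ∈ O θ₀ →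
    Bornology.IsBounded (Set.range w) ∧
    ∀ i : Fin N, Tendsto (fun t => fun k : Fin d => w t (Sum.inl (i, k))) atTop
      (𝓝 (optMap C Γ *ᵥ θ₀))

/-! ### Initialization sets -/

/-- Orthogonal complement with respect to the standard scalar product. -/
def orthCompl {ι : Type*} [Fintype ι] (V : Submodule ℝ (ι → ℝ)) : Set (ι → ℝ) :=
  {u | ∀ v ∈ V, u ⬝ᵥ v = 0}

/-- The affine set `P θ₀ + V`. -/
def initSet {ι : Type*} {p : ℕ} (P : Matrix ι (Fin p) ℝ) (V : Submodule ℝ (ι → ℝ))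
    (θ₀ : Fin p → ℝ) : Set (ι → ℝ) :=
  {w | ∃ v ∈ V, w = P *ᵥ θ₀ + v}

/-- `Π` solves the regulator equations `Π = F Π + G`, `[I 0] Π = 𝐈 Σ`, `T₂ᵀ (Π - P) = 0`, the
last one being imposed for all vectors of `V^⊥`, which is the column space of `T₂`. -/
def Controller.RegulatorEq {N d nz p : ℕ} (K : Controller N d nz)
    (C : Fin N → Matrix (Fin d) (Fin d) ℝ) (Γ : Fin N → Matrix (Fin d) (Fin p) ℝ)
    (V : Submodule ℝ (Idx N d nz → ℝ)) (P Pi : Matrix (Idx N d nz) (Fin p) ℝ) : Prop :=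
  Pi = K.F C * Pi + K.G C Γ ∧
  Pi.toRows₁ = consensus N d * optMap C Γ ∧
  ∀ u ∈ orthCompl V, u ᵥ* (Pi - P) = 0

/-- `P` is an admissible bias for the initialization set `P θ₀ + V`: its image lies in `V^⊥`, and
the regulator equations have a solution `Π`. -/
def Controller.AdmissibleBias {N d nz p : ℕ} (K : Controller N d nz)
    (C : Fin N → Matrix (Fin d) (Fin d) ℝ) (Γ : Fin N → Matrix (Fin d) (Fin p) ℝ)
    (V : Submodule ℝ (Idx N d nz → ℝ)) (P : Matrix (Idx N d nz) (Fin p) ℝ) : Prop :=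
  (∀ θ₀, P *ᵥ θ₀ ∈ orthCompl V) ∧ ∃ Pi, K.RegulatorEq C Γ V P Pi

/-! ### Gradient tracking -/

/-- The gradient-tracking controller: `Φ = Ã ⊗ I`, `Bx = 0`, `By = Ã ⊗ I - I`, `Kx = A ⊗ I`,
with free gains `Kz` and `Ky`. -/
def gtController {N : ℕ} (d : ℕ) (A At : Matrix (Fin N) (Fin N) ℝ)
    (Kz Ky : Matrix (Fin N × Fin d) (Fin N × Fin d) ℝ) : Controller N d d where
  Φ := lift d At
  Bx := 0
  By := lift d At - 1
  Kz := Kz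
  Kx := lift d A
  Ky := Ky

/-- Reachable subspace of the pair `(F, B)`. -/
def reachableSubspace {ι κ : Type*} [Fintype ι] [DecidableEq ι] [Fintype κ]
    (F : Matrix ι ι ℝ) (B : Matrix ι κ ℝ) : Submodule ℝ (ι → ℝ) :=
  ⨆ k : ℕ, LinearMap.range (F ^ k * B).mulVecLin

/-- The subspace `V`: the reachable subspace of `(F₀, B₀)`, where `F₀` is the closed-loop matrix
with zero gains and `B₀ = col(I, 0)`. -/
def gtSubspace {N d : ℕ} (A At : Matrix (Fin N) (Fin N) ℝ)
    (C : Fin N → Matrix (Fin d) (Fin d) ℝ) : Submodule ℝ (Idx N d d → ℝ) :=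
  reachableSubspace ((gtController d A At 0 0).F C)
    (Matrix.fromRows (1 : Matrix (Fin N × Fin d) (Fin N × Fin d) ℝ)
      (0 : Matrix (Fin N × Fin d) (Fin N × Fin d) ℝ))

/-- With gains `Kz = Ky = K`, an initialization set `O = P θ₀ + V` as described exists, and from
every such set the gradient-tracking controller solves the set-point control problem. -/
def GTSolves {N d p : ℕ} (A At : Matrix (Fin N) (Fin N) ℝ)
    (C : Fin N → Matrix (Fin d) (Fin d) ℝ) (Γ : Fin N → Matrix (Fin d) (Fin p) ℝ)
    (K : Matrix (Fin N × Fin d) (Fin N × Fin d) ℝ) : Prop :=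
  (∃ P, (gtController d A At K K).AdmissibleBias C Γ (gtSubspace A At C) P) ∧
  ∀ P, (gtController d A At K K).AdmissibleBias C Γ (gtSubspace A At C) P →
    (gtController d A At K K).SolvesFrom C Γ (initSet P (gtSubspace A At C))

end GradientTracking

namespace GradientTracking

/-! ### Stochastic matrices on a connected graph -/

/-! The error `y = w - Π θ₀` obeys `y⁺ = F y`, so everything reduces to driving `y` to zero. Since
the columns of `Ã` sum to one, the vectors `1 ⊗ e_k` on the `z` block are left-invariant under `F₀`
and vanish on `B₀`. They therefore lie in `V^⊥`, and the third regulator equation makes the `z` part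
of the error sum to zero. This is the only information about the initialization that convergence
needs.

Let `s = z + C x` be the tracker of the error system. Then `x⁺ = A x - Λ s` and `s⁺ = Ã s + C (x⁺ -
x)`, with `∑ s_i = ∑ C_i x_i` for all time. Writing `s_i = r_i t_i` with `Ã r = r` turns `Ã` into a
row stochastic `B` with stationary distribution `r` (`exists_scaling`). With `μ` stationary for `A`,
both averagings contract the weighted variance (`exists_contraction`).

The mean `e = ∑ μ_i x_i` moves by `-∑ μ_i Λ_i r_i t_i`. Near consensus of `t` this is `-D σ`, with
`D` a positive diagonal matrix and `σ = ∑ C_i x_i`, which is `S e` up to disagreement, `S = ∑ C_i`.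
Hence `eᵀ S e` decreases at rate about `2 σᵀ D σ`, even though `D` is not scalar. Adding the
disagreement of `x` (weight `α`) and of `t` gives the Lyapunov function of `exists_lyap_decrease`.
All perturbations are absorbed by the contractions or bounded by `γ` times the dissipation itself
(`wsq_gainStep_le`), so the threshold needs no lower bound on the gains or on their ratios.
Summability of the decrease then gives convergence, without any spectral estimate of `F`. -/

lemma Matches.nonneg {N : ℕ} {G : SimpleGraph (Fin N)} {A : Matrix (Fin N) (Fin N) ℝ}
    (hA : Matches G A) (i j : Fin N) : 0 ≤ A i j := by
  by_cases h : i = j ∨ G.Adj i j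
  · exact ((hA i j).1 h).le
  · exact ((hA i j).2 h).ge

lemma RowStochastic.sum_row {N : ℕ} {A : Matrix (Fin N) (Fin N) ℝ} (hA : RowStochastic A)
    (i : Fin N) : ∑ j, A i j = 1 := by
  have := congrFun hA i
  simpa [Matrix.mulVec, dotProduct] using this

/-- A property which is inherited by neighbours holds everywhere once it holds somewhere. -/
lemma forall_of_adj_of_connected {V : Type*} {G : SimpleGraph V} (hG : G.Connected) {p : V → Prop}
    (hstep : ∀ i j, G.Adj i j → p i → p j) {i : V} (hi : p i) (j : V) : p j := by
  obtain ⟨w⟩ := hG.preconnected i j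
  induction w with
  | nil => exact hi
  | cons h _ ih => exact ih (hstep _ _ h hi)

/-- The stationary distribution of a stochastic matrix on a connected graph. -/
theorem exists_stationary {N : ℕ} {G : SimpleGraph (Fin N)} (hG : G.Connected)
    {A : Matrix (Fin N) (Fin N) ℝ} (hA : Matches G A) (hAr : RowStochastic A) :
    ∃ μ : Fin N → ℝ, (∀ i, 0 < μ i) ∧ ∑ i, μ i = 1 ∧ ∀ j, ∑ i, μ i * A i j = μ j := by
  have hne := hG.nonempty
  have hdet : (A - 1).det = 0 := by
    refine Matrix.exists_mulVec_eq_zero_iff.1 ⟨fun _ => 1, ?_, ?_⟩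
    · intro h
      exact one_ne_zero (congrFun h (Classical.arbitrary _))
    · rw [Matrix.sub_mulVec, hAr, Matrix.one_mulVec, sub_self]
  obtain ⟨v, hv0, hv⟩ := Matrix.exists_vecMul_eq_zero_iff.2 hdet
  have hvA : ∀ j, ∑ i, v i * A i j = v j := by
    intro j
    have := congrFun hv j
    rw [Matrix.vecMul_sub, Matrix.vecMul_one] at this
    simpa [Matrix.vecMul, dotProduct, sub_eq_zero] using this
  -- Perron argument: `|v| ≤ |v| A` entrywise, and unit row sums give both sides the same total, so
  -- equality holds and `|v|` is itself invariant.
  have hle : ∀ j, |v j| ≤ ∑ i, |v i| * A i j := by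
    intro j
    calc |v j| = |∑ i, v i * A i j| := by rw [hvA]
      _ ≤ ∑ i, |v i * A i j| := Finset.abs_sum_le_sum_abs _ _
      _ = ∑ i, |v i| * A i j := by
        simp_rw [abs_mul, abs_of_nonneg (hA.nonneg _ _)]
  have hsum : ∑ j, |v j| = ∑ j, ∑ i, |v i| * A i j := by
    rw [Finset.sum_comm]
    simp_rw [← Finset.mul_sum, hAr.sum_row, mul_one]
  have heq : ∀ j, ∑ i, |v i| * A i j = |v j| := by
    intro j
    exact ((Finset.sum_eq_sum_iff_of_le fun j _ => hle j).1 hsum j (Finset.mem_univ _)).symm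
  obtain ⟨i₀, hi₀⟩ : ∃ i, v i ≠ 0 := by
    by_contra! h
    exact hv0 (funext h)
  have hpos : ∀ j, 0 < |v j| := by
    refine forall_of_adj_of_connected hG ?_ (abs_pos.2 hi₀)
    intro i j hij hi
    rw [← heq j]
    refine lt_of_lt_of_le (mul_pos hi ((hA i j).1 (Or.inr hij)))
      (Finset.single_le_sum (f := fun i => |v i| * A i j) ?_ (Finset.mem_univ i))
    exact fun i _ => mul_nonneg (abs_nonneg _) (hA.nonneg _ _)
  have hs : 0 < ∑ i, |v i| := Finset.sum_pos (fun i _ => hpos i) Finset.univ_nonempty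
  refine ⟨fun i => |v i| / ∑ i, |v i|, fun i => div_pos (hpos i) hs, ?_, fun j => ?_⟩
  · rw [← Finset.sum_div, div_self hs.ne']
  · simp_rw [div_mul_eq_mul_div]
    rw [← Finset.sum_div, heq]

/-- The loss of variance under averaging by a stochastic matrix. -/
lemma sum_sq_sub_sum_sq_mulVec {N : ℕ} {A : Matrix (Fin N) (Fin N) ℝ} (hAr : RowStochastic A)
    {μ : Fin N → ℝ} (hμA : ∀ j, ∑ i, μ i * A i j = μ j) (u : Fin N → ℝ) :
    ∑ i, μ i * u i ^ 2 - ∑ i, μ i * (A *ᵥ u) i ^ 2 =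
      ∑ i, ∑ j, μ i * (A i j * (u j - (A *ᵥ u) i) ^ 2) := by
  have h1 : ∑ i, μ i * u i ^ 2 = ∑ i, ∑ j, μ i * (A i j * u j ^ 2) := by
    rw [Finset.sum_comm]
    refine Finset.sum_congr rfl fun j _ => ?_
    rw [← hμA j, Finset.sum_mul]
    exact Finset.sum_congr rfl fun i _ => by ring
  rw [h1, ← Finset.sum_sub_distrib]
  refine Finset.sum_congr rfl fun i _ => ?_
  rw [← Finset.mul_sum, ← Finset.mul_sum, ← mul_sub]
  congr 1
  have h2 : ∑ j, A i j * u j = (A *ᵥ u) i := rfl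
  have h3 : ∑ j, A i j * (u j - (A *ᵥ u) i) ^ 2 = ∑ j, A i j * u j ^ 2
      - 2 * (A *ᵥ u) i * ∑ j, A i j * u j + (A *ᵥ u) i ^ 2 * ∑ j, A i j := by
    rw [Finset.mul_sum, Finset.mul_sum, ← Finset.sum_sub_distrib, ← Finset.sum_add_distrib]
    exact Finset.sum_congr rfl fun j _ => by ring
  rw [h3, h2, hAr.sum_row]
  ring

lemma sum_sq_mulVec_le {N : ℕ} {G : SimpleGraph (Fin N)}
    {A : Matrix (Fin N) (Fin N) ℝ} (hA : Matches G A) (hAr : RowStochastic A)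
    {μ : Fin N → ℝ} (hμ : ∀ i, 0 < μ i) (hμA : ∀ j, ∑ i, μ i * A i j = μ j) (u : Fin N → ℝ) :
    ∑ i, μ i * (A *ᵥ u) i ^ 2 ≤ ∑ i, μ i * u i ^ 2 := by
  rw [← sub_nonneg, sum_sq_sub_sum_sq_mulVec hAr hμA]
  exact Finset.sum_nonneg fun i _ => Finset.sum_nonneg fun j _ =>
    mul_nonneg (hμ i).le (mul_nonneg (hA.nonneg _ _) (sq_nonneg _))

/-- Equality kills every term of the variance loss, so `u j = (A u) i` whenever `A i j > 0`. The
positive diagonal gives `u i = (A u) i` as well, so `u` agrees along edges, is constant by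
connectedness, and vanishes because its mean does. -/
lemma sum_sq_mulVec_lt {N : ℕ} {G : SimpleGraph (Fin N)} (hG : G.Connected)
    {A : Matrix (Fin N) (Fin N) ℝ} (hA : Matches G A) (hAr : RowStochastic A)
    {μ : Fin N → ℝ} (hμ : ∀ i, 0 < μ i) (hμA : ∀ j, ∑ i, μ i * A i j = μ j) {u : Fin N → ℝ}
    (hu0 : u ≠ 0) (hu : ∑ i, μ i * u i = 0) :
    ∑ i, μ i * (A *ᵥ u) i ^ 2 < ∑ i, μ i * u i ^ 2 := by
  refine lt_of_le_of_ne (sum_sq_mulVec_le hA hAr hμ hμA u) fun h => hu0 ?_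
  have hE := sum_sq_sub_sum_sq_mulVec hAr hμA u
  rw [h, sub_self] at hE
  have hnn : ∀ i j, 0 ≤ μ i * (A i j * (u j - (A *ᵥ u) i) ^ 2) := fun i j =>
    mul_nonneg (hμ i).le (mul_nonneg (hA.nonneg _ _) (sq_nonneg _))
  have hz : ∀ i j, 0 < A i j → u j = (A *ᵥ u) i := by
    intro i j hij
    have h1 := (Finset.sum_eq_zero_iff_of_nonneg
      fun i _ => Finset.sum_nonneg fun j _ => hnn i j).1 hE.symm i (Finset.mem_univ _)
    have h2 := (Finset.sum_eq_zero_iff_of_nonneg fun j _ => hnn i j).1 h1 j (Finset.mem_univ _)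
    simpa [(hμ i).ne', hij.ne', sub_eq_zero] using h2
  have hadj : ∀ i j, G.Adj i j → u i = u j := fun i j hij =>
    (hz i i ((hA i i).1 (Or.inl rfl))).trans (hz i j ((hA i j).1 (Or.inr hij))).symm
  have hne := hG.nonempty
  have hconst : ∀ j, u j = u (Classical.arbitrary _) :=
    forall_of_adj_of_connected hG (p := fun j => u j = u (Classical.arbitrary _))
      (fun i j hij hi => (hadj i j hij).symm.trans hi) rfl
  funext j
  have hs : 0 < ∑ i, μ i := Finset.sum_pos (fun i _ => hμ i) Finset.univ_nonempty
  have h4 : (∑ i, μ i) * u (Classical.arbitrary _) = 0 := by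
    rw [Finset.sum_mul, ← hu]
    exact Finset.sum_congr rfl fun i _ => by rw [hconst i]
  rw [hconst j]
  simpa [hs.ne'] using h4

/-- Averaging by a stochastic matrix on a connected graph contracts the variance. -/
theorem exists_contraction {N : ℕ} {G : SimpleGraph (Fin N)} (hG : G.Connected)
    {A : Matrix (Fin N) (Fin N) ℝ} (hA : Matches G A) (hAr : RowStochastic A)
    {μ : Fin N → ℝ} (hμ : ∀ i, 0 < μ i) (hμA : ∀ j, ∑ i, μ i * A i j = μ j) :
    ∃ c : ℝ, 0 < c ∧ ∀ u : Fin N → ℝ, ∑ i, μ i * u i = 0 →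
      ∑ i, μ i * (A *ᵥ u) i ^ 2 ≤ (1 - c) * ∑ i, μ i * u i ^ 2 := by
  have hne := hG.nonempty
  -- The relative variance loss is homogeneous of degree zero, so its minimum over this compact
  -- slice of the sphere is a rate valid for all mean-zero vectors.
  set S : Set (Fin N → ℝ) := Metric.sphere 0 1 ∩ {u | ∑ i, μ i * u i = 0} with hS
  have hpos : ∀ u : Fin N → ℝ, u ≠ 0 → 0 < ∑ i, μ i * u i ^ 2 := by
    intro u hu
    obtain ⟨i, hi⟩ : ∃ i, u i ≠ 0 := by
      by_contra! h
      exact hu (funext h)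
    exact Finset.sum_pos' (fun i _ => mul_nonneg (hμ i).le (sq_nonneg _))
      ⟨i, Finset.mem_univ _, mul_pos (hμ i) (by positivity)⟩
  have hS0 : ∀ u ∈ S, u ≠ 0 := by
    rintro u ⟨hu, -⟩ rfl
    simp at hu
  have hScomp : IsCompact S :=
    (isCompact_sphere 0 1).inter_right (isClosed_eq (by fun_prop) continuous_const)
  -- If `S` is empty, the only mean-zero vector is zero and any rate works.
  rcases S.eq_empty_or_nonempty with hempty | hnon
  · refine ⟨1, one_pos, fun u hu => ?_⟩
    have hu0 : u = 0 := by
      by_contra h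
      have : ‖u‖⁻¹ • u ∈ S := by
        refine ⟨by simp [norm_smul, h], ?_⟩
        show ∑ i, μ i * (‖u‖⁻¹ * u i) = 0
        simp_rw [mul_left_comm (μ _)]
        rw [← Finset.mul_sum, hu, mul_zero]
      rw [hempty] at this
      exact this
    simp [hu0]
  · have hcont : ContinuousOn
        (fun u : Fin N → ℝ => (∑ i, μ i * u i ^ 2 - ∑ i, μ i * (A *ᵥ u) i ^ 2) /
          ∑ i, μ i * u i ^ 2) S := by
      refine ContinuousOn.div ?_ (by fun_prop) fun u hu => (hpos u (hS0 u hu)).ne'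
      refine Continuous.continuousOn ?_
      simp only [Matrix.mulVec, dotProduct]
      fun_prop
    obtain ⟨v, hvS, hv⟩ := hScomp.exists_isMinOn hnon hcont
    refine ⟨_, div_pos (sub_pos.2 (sum_sq_mulVec_lt hG hA hAr hμ hμA (hS0 v hvS) hvS.2))
      (hpos v (hS0 v hvS)), fun u hu => ?_⟩
    set c := (∑ i, μ i * v i ^ 2 - ∑ i, μ i * (A *ᵥ v) i ^ 2) / ∑ i, μ i * v i ^ 2 with hc
    by_cases h : u = 0
    · simp [h]
    have hn : ‖u‖ ≠ 0 := norm_ne_zero_iff.2 h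
    have hmem : ‖u‖⁻¹ • u ∈ S := by
      refine ⟨by simp [norm_smul, h], ?_⟩
      show ∑ i, μ i * (‖u‖⁻¹ * u i) = 0
      simp_rw [mul_left_comm (μ _)]
      rw [← Finset.mul_sum, hu, mul_zero]
    have hmin := isMinOn_iff.1 hv _ hmem
    have e1 : ∀ w : Fin N → ℝ, ∑ i, μ i * (‖u‖⁻¹ • w) i ^ 2 =
        (‖u‖⁻¹) ^ 2 * ∑ i, μ i * w i ^ 2 := by
      intro w
      rw [Finset.mul_sum]
      exact Finset.sum_congr rfl fun i _ => by simp only [Pi.smul_apply, smul_eq_mul]; ring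
    rw [Matrix.mulVec_smul, e1, e1, ← mul_sub,
      mul_div_mul_left _ _ (pow_ne_zero 2 (inv_ne_zero hn)), ← hc, le_div_iff₀ (hpos u h)] at hmin
    linarith

/-! ### Weighted means and sums of squares -/

/-- The weighted mean of the rows of `x`. -/
def wmean {N d : ℕ} (μ : Fin N → ℝ) (x : Matrix (Fin N) (Fin d) ℝ) : Fin d → ℝ :=
  fun k => ∑ i, μ i * x i k

/-- The weighted sum of the squared norms of the rows of `x`. -/
def wsq {N d : ℕ} (μ : Fin N → ℝ) (x : Matrix (Fin N) (Fin d) ℝ) : ℝ :=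
  ∑ k, ∑ i, μ i * x i k ^ 2

/-- The deviation of the rows of `x` from their weighted mean. -/
def dev {N d : ℕ} (μ : Fin N → ℝ) (x : Matrix (Fin N) (Fin d) ℝ) : Matrix (Fin N) (Fin d) ℝ :=
  Matrix.of fun i k => x i k - wmean μ x k

section

variable {N d : ℕ} {μ : Fin N → ℝ}

lemma wmean_add (x y : Matrix (Fin N) (Fin d) ℝ) : wmean μ (x + y) = wmean μ x + wmean μ y := by
  funext k
  simp [wmean, mul_add, Finset.sum_add_distrib]

lemma wmean_sub (x y : Matrix (Fin N) (Fin d) ℝ) : wmean μ (x - y) = wmean μ x - wmean μ y := by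
  funext k
  simp [wmean, mul_sub, Finset.sum_sub_distrib]

lemma dev_add (x y : Matrix (Fin N) (Fin d) ℝ) : dev μ (x + y) = dev μ x + dev μ y := by
  ext i k
  simp only [dev, wmean_add, Matrix.of_apply, Matrix.add_apply, Pi.add_apply]
  ring

lemma dev_sub (x y : Matrix (Fin N) (Fin d) ℝ) : dev μ (x - y) = dev μ x - dev μ y := by
  ext i k
  simp only [dev, wmean_sub, Matrix.of_apply, Matrix.sub_apply, Pi.sub_apply]
  ring

lemma wmean_mul {A : Matrix (Fin N) (Fin N) ℝ} (hμA : ∀ j, ∑ i, μ i * A i j = μ j)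
    (x : Matrix (Fin N) (Fin d) ℝ) : wmean μ (A * x) = wmean μ x := by
  funext k
  simp only [wmean, Matrix.mul_apply, Finset.mul_sum]
  rw [Finset.sum_comm]
  refine Finset.sum_congr rfl fun j _ => ?_
  conv_rhs => rw [← hμA j, Finset.sum_mul]
  exact Finset.sum_congr rfl fun i _ => by ring

lemma mul_dev {A : Matrix (Fin N) (Fin N) ℝ} (hAr : RowStochastic A)
    (x : Matrix (Fin N) (Fin d) ℝ) :
    A * dev μ x = A * x - Matrix.of fun _ k => wmean μ x k := by
  ext i k
  simp only [Matrix.mul_apply, dev, Matrix.of_apply, Matrix.sub_apply, mul_sub,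
    Finset.sum_sub_distrib]
  rw [← Finset.sum_mul, hAr.sum_row, one_mul]

lemma dev_mul {A : Matrix (Fin N) (Fin N) ℝ} (hAr : RowStochastic A)
    (hμA : ∀ j, ∑ i, μ i * A i j = μ j) (x : Matrix (Fin N) (Fin d) ℝ) :
    dev μ (A * x) = A * dev μ x := by
  rw [mul_dev hAr]
  ext i k
  simp [dev, wmean_mul hμA]

/-- `A - 1` kills consensus vectors, so the averaging step moves `x` only by an amount controlled by
the disagreement. -/
lemma mul_sub_self_eq_dev {A : Matrix (Fin N) (Fin N) ℝ} (hAr : RowStochastic A)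
    (x : Matrix (Fin N) (Fin d) ℝ) : A * x - x = A * dev μ x - dev μ x := by
  rw [mul_dev hAr]
  ext i k
  simp [dev]

lemma wmean_dev (hμ1 : ∑ i, μ i = 1) (x : Matrix (Fin N) (Fin d) ℝ) : wmean μ (dev μ x) = 0 := by
  funext k
  simp only [wmean, dev, Matrix.of_apply, mul_sub, Finset.sum_sub_distrib, Pi.zero_apply]
  rw [← Finset.sum_mul, hμ1, one_mul, sub_self]

lemma wsq_nonneg (hμ : ∀ i, 0 < μ i) (x : Matrix (Fin N) (Fin d) ℝ) : 0 ≤ wsq μ x :=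
  Finset.sum_nonneg fun _ _ => Finset.sum_nonneg fun i _ => mul_nonneg (hμ i).le (sq_nonneg _)

/-- Young's inequality. The parameter is left free so that `τ = c` can be paired with a contraction
factor `1 - c`, giving `(1 + c)(1 - c) = 1 - c ^ 2 < 1`. -/
lemma wsq_sub_le (hμ : ∀ i, 0 < μ i) {τ : ℝ} (hτ : 0 < τ) (x y : Matrix (Fin N) (Fin d) ℝ) :
    wsq μ (x - y) ≤ (1 + τ) * wsq μ x + (1 + τ⁻¹) * wsq μ y := by
  simp only [wsq, Finset.mul_sum, ← Finset.sum_add_distrib]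
  refine Finset.sum_le_sum fun k _ => Finset.sum_le_sum fun i _ => ?_
  have h : (x i k - y i k) ^ 2 ≤ (1 + τ) * x i k ^ 2 + (1 + τ⁻¹) * y i k ^ 2 := by
    have h1 : 0 ≤ τ * (x i k + τ⁻¹ * y i k) ^ 2 := by positivity
    have h2 : τ * (x i k + τ⁻¹ * y i k) ^ 2 =
        τ * x i k ^ 2 + 2 * (τ * τ⁻¹) * x i k * y i k + τ * τ⁻¹ * τ⁻¹ * y i k ^ 2 := by ring
    rw [mul_inv_cancel₀ hτ.ne'] at h2
    linarith [h1, h2]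
  rw [Matrix.sub_apply]
  have := mul_le_mul_of_nonneg_left h (hμ i).le
  linarith

lemma wsq_neg (x : Matrix (Fin N) (Fin d) ℝ) : wsq μ (-x) = wsq μ x := by
  simp [wsq]

lemma wsq_add_le (hμ : ∀ i, 0 < μ i) {τ : ℝ} (hτ : 0 < τ) (x y : Matrix (Fin N) (Fin d) ℝ) :
    wsq μ (x + y) ≤ (1 + τ) * wsq μ x + (1 + τ⁻¹) * wsq μ y := by
  have := wsq_sub_le hμ hτ x (-y)
  rwa [sub_neg_eq_add, wsq_neg] at this

lemma wsq_eq (hμ1 : ∑ i, μ i = 1) (x : Matrix (Fin N) (Fin d) ℝ) :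
    wsq μ x = wsq μ (dev μ x) + wmean μ x ⬝ᵥ wmean μ x := by
  simp only [wsq, dotProduct, ← Finset.sum_add_distrib]
  refine Finset.sum_congr rfl fun k _ => ?_
  have h1 : ∑ i, μ i * x i k = wmean μ x k := rfl
  have h : ∑ i, μ i * dev μ x i k ^ 2 = ∑ i, μ i * x i k ^ 2
      - 2 * wmean μ x k * ∑ i, μ i * x i k + wmean μ x k ^ 2 * ∑ i, μ i := by
    rw [Finset.mul_sum, Finset.mul_sum, ← Finset.sum_sub_distrib, ← Finset.sum_add_distrib]
    exact Finset.sum_congr rfl fun i _ => by simp only [dev, Matrix.of_apply]; ring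
  rw [h, h1, hμ1]
  ring

lemma dotProduct_self_nonneg' {n : Type*} [Fintype n] (v : n → ℝ) : 0 ≤ v ⬝ᵥ v :=
  Finset.sum_nonneg fun _ _ => mul_self_nonneg _

lemma wsq_dev_le (hμ1 : ∑ i, μ i = 1) (x : Matrix (Fin N) (Fin d) ℝ) :
    wsq μ (dev μ x) ≤ wsq μ x := by
  rw [wsq_eq hμ1 x]
  linarith [dotProduct_self_nonneg' (wmean μ x)]

lemma wmean_sq_le (hμ : ∀ i, 0 < μ i) (hμ1 : ∑ i, μ i = 1) (x : Matrix (Fin N) (Fin d) ℝ) :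
    wmean μ x ⬝ᵥ wmean μ x ≤ wsq μ x := by
  rw [wsq_eq hμ1 x]
  linarith [wsq_nonneg hμ (dev μ x)]

lemma wsq_mul_le {G : SimpleGraph (Fin N)} {A : Matrix (Fin N) (Fin N) ℝ} (hA : Matches G A)
    (hAr : RowStochastic A) (hμ : ∀ i, 0 < μ i) (hμA : ∀ j, ∑ i, μ i * A i j = μ j)
    (x : Matrix (Fin N) (Fin d) ℝ) : wsq μ (A * x) ≤ wsq μ x :=
  Finset.sum_le_sum fun k _ => sum_sq_mulVec_le hA hAr hμ hμA fun i => x i k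

lemma wsq_mul_dev_le {A : Matrix (Fin N) (Fin N) ℝ} {c : ℝ}
    (hc : ∀ u : Fin N → ℝ, ∑ i, μ i * u i = 0 →
      ∑ i, μ i * (A *ᵥ u) i ^ 2 ≤ (1 - c) * ∑ i, μ i * u i ^ 2)
    (hμ1 : ∑ i, μ i = 1) (x : Matrix (Fin N) (Fin d) ℝ) :
    wsq μ (A * dev μ x) ≤ (1 - c) * wsq μ (dev μ x) := by
  simp only [wsq, Finset.mul_sum (s := (Finset.univ : Finset (Fin d)))]
  exact Finset.sum_le_sum fun k _ => hc _ (congrFun (wmean_dev hμ1 x) k)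

lemma exists_mulVec_sq_le {m n : Type*} [Fintype m] [Fintype n] (M : Matrix m n ℝ) :
    ∃ K : ℝ, 0 ≤ K ∧ ∀ v : n → ℝ, (M *ᵥ v) ⬝ᵥ (M *ᵥ v) ≤ K * (v ⬝ᵥ v) := by
  refine ⟨∑ i, ∑ j, M i j ^ 2, Finset.sum_nonneg fun _ _ => Finset.sum_nonneg fun _ _ =>
    sq_nonneg _, fun v => ?_⟩
  rw [Finset.sum_mul]
  simp only [dotProduct]
  refine Finset.sum_le_sum fun i _ => ?_
  have := Finset.sum_mul_sq_le_sq_mul_sq Finset.univ (M i) v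
  simpa [Matrix.mulVec, dotProduct, ← sq] using this

lemma wsq_eq_sum_row (x : Matrix (Fin N) (Fin d) ℝ) : wsq μ x = ∑ i, μ i * (x i ⬝ᵥ x i) := by
  rw [wsq, Finset.sum_comm]
  refine Finset.sum_congr rfl fun i _ => ?_
  simp only [dotProduct, Finset.mul_sum, sq]

/-- Rowwise linear maps are bounded for weighted sums of squares. -/
lemma exists_wsq_rowwise_le (ν : Fin N → ℝ) (hμ : ∀ i, 0 < μ i) (hν : ∀ i, 0 < ν i)
    (M : Fin N → Matrix (Fin d) (Fin d) ℝ) :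
    ∃ K : ℝ, 0 ≤ K ∧ ∀ x : Matrix (Fin N) (Fin d) ℝ,
      wsq ν (Matrix.of fun i => M i *ᵥ x i) ≤ K * wsq μ x := by
  choose K hK0 hK using fun i => exists_mulVec_sq_le (M i)
  have hnn : ∀ i, 0 ≤ ν i * K i / μ i := fun i =>
    div_nonneg (mul_nonneg (hν i).le (hK0 i)) (hμ i).le
  refine ⟨∑ i, ν i * K i / μ i, Finset.sum_nonneg fun i _ => hnn i, fun x => ?_⟩
  rw [wsq_eq_sum_row, wsq_eq_sum_row, Finset.mul_sum]
  refine Finset.sum_le_sum fun i _ => ?_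
  have h1 : ν i * K i / μ i ≤ ∑ i, ν i * K i / μ i :=
    Finset.single_le_sum (f := fun i => ν i * K i / μ i) (fun i _ => hnn i) (Finset.mem_univ i)
  calc ν i * ((M i *ᵥ x i) ⬝ᵥ (M i *ᵥ x i)) ≤ ν i * (K i * (x i ⬝ᵥ x i)) :=
        mul_le_mul_of_nonneg_left (hK i _) (hν i).le
    _ = ν i * K i / μ i * (μ i * (x i ⬝ᵥ x i)) := by
        have := (hμ i).ne'
        field_simp
    _ ≤ _ := mul_le_mul_of_nonneg_right h1 (mul_nonneg (hμ i).le (dotProduct_self_nonneg' _))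

/-- The sum of rowwise linear maps is bounded for weighted sums of squares. -/
lemma exists_sum_rowwise_sq_le (hμ : ∀ i, 0 < μ i) (M : Fin N → Matrix (Fin d) (Fin d) ℝ) :
    ∃ K : ℝ, 0 ≤ K ∧ ∀ x : Matrix (Fin N) (Fin d) ℝ,
      (∑ i, M i *ᵥ x i) ⬝ᵥ (∑ i, M i *ᵥ x i) ≤ K * wsq μ x := by
  obtain ⟨K, hK0, hK⟩ := exists_wsq_rowwise_le (fun _ => 1) hμ (fun _ => one_pos) M
  refine ⟨N * K, by positivity, fun x => ?_⟩
  refine le_trans ?_ (le_trans (mul_le_mul_of_nonneg_left (hK x) (Nat.cast_nonneg N))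
    (mul_assoc _ _ _).ge)
  simp only [wsq, dotProduct, Finset.mul_sum (s := (Finset.univ : Finset (Fin d)))]
  refine Finset.sum_le_sum fun k _ => ?_
  have := sq_sum_le_card_mul_sum_sq (s := (Finset.univ : Finset (Fin N)))
    (f := fun i => (M i *ᵥ x i) k)
  simpa [← sq, Finset.sum_apply] using this

end

/-! ### The Lyapunov function -/

section

variable {N d : ℕ}

/-- The step `Λ s` with the diagonal gains `lam`, where `s i = r i • t i`. -/
def gainStep (r : Fin N → ℝ) (lam t : Matrix (Fin N) (Fin d) ℝ) : Matrix (Fin N) (Fin d) ℝ :=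
  Matrix.of fun i k => lam i k * (r i * t i k)

/-- The dissipation of the average dynamics. -/
def dissip (μ r : Fin N → ℝ) (lam t : Matrix (Fin N) (Fin d) ℝ) : ℝ :=
  ∑ k, ∑ i, μ i * r i * lam i k * wmean r t k ^ 2

/-- The Lyapunov function: the cost at the average, plus the consensus and tracking errors. -/
def lyap (μ r : Fin N → ℝ) (C : Fin N → Matrix (Fin d) (Fin d) ℝ) (α : ℝ)
    (x t : Matrix (Fin N) (Fin d) ℝ) : ℝ :=
  wmean μ x ⬝ᵥ ((∑ i, C i) *ᵥ wmean μ x) + α * wsq μ (dev μ x) + wsq r (dev r t)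

lemma le_one_of_sum_eq_one {μ : Fin N → ℝ} (hμ : ∀ i, 0 < μ i) (hμ1 : ∑ i, μ i = 1) (i : Fin N) :
    μ i ≤ 1 :=
  hμ1 ▸ Finset.single_le_sum (fun j _ => (hμ j).le) (Finset.mem_univ i)

lemma eq_wmean_add_dev (μ : Fin N → ℝ) (x : Matrix (Fin N) (Fin d) ℝ) (i : Fin N) (k : Fin d) :
    x i k = wmean μ x k + dev μ x i k := by
  simp [dev]

lemma dissip_nonneg {μ r : Fin N → ℝ} (hμ : ∀ i, 0 < μ i) (hr : ∀ i, 0 < r i)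
    {lam : Matrix (Fin N) (Fin d) ℝ} (hlam : ∀ i k, 0 < lam i k) (t : Matrix (Fin N) (Fin d) ℝ) :
    0 ≤ dissip μ r lam t :=
  Finset.sum_nonneg fun k _ => Finset.sum_nonneg fun i _ =>
    mul_nonneg (mul_pos (mul_pos (hμ i) (hr i)) (hlam i k)).le (sq_nonneg _)

/-- The squared step is quadratic in the gains: one factor `lam i k * r i ≤ γ` splits off, and what
remains carries the weight `μ i * r i * lam i k` of the dissipation. The step is thus small relative
to the decrease produced by the same gains. -/
lemma wsq_gainStep_le {μ r : Fin N → ℝ} (hμ : ∀ i, 0 < μ i) (hμ1 : ∑ i, μ i = 1)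
    (hr : ∀ i, 0 < r i) (hr1 : ∑ i, r i = 1) {lam : Matrix (Fin N) (Fin d) ℝ} {γ : ℝ}
    (hγ : γ ≤ 1) (hlam : ∀ i k, 0 < lam i k ∧ lam i k ≤ γ) (t : Matrix (Fin N) (Fin d) ℝ) :
    wsq μ (gainStep r lam t) ≤ 2 * γ * (dissip μ r lam t + wsq r (dev r t)) := by
  simp only [wsq, dissip, ← Finset.sum_add_distrib, Finset.mul_sum]
  refine Finset.sum_le_sum fun k _ => Finset.sum_le_sum fun i _ => ?_
  simp only [gainStep, Matrix.of_apply]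
  rw [eq_wmean_add_dev r t i k]
  set σ := wmean r t k
  set u := dev r t i k
  obtain ⟨hl0, hl⟩ := hlam i k
  have hμi := hμ i
  have hri := hr i
  have hγ0 : 0 < γ := hl0.trans_le hl
  have h0 : lam i k * r i ≤ γ := by
    calc lam i k * r i ≤ γ * 1 := mul_le_mul hl (le_one_of_sum_eq_one hr hr1 i) hri.le hγ0.le
      _ = γ := mul_one γ
  have h1 : μ i * (lam i k * (r i * (σ + u))) ^ 2 ≤
      γ * (μ i * r i * lam i k * (2 * σ ^ 2 + 2 * u ^ 2)) := by
    have : (σ + u) ^ 2 ≤ 2 * σ ^ 2 + 2 * u ^ 2 := by linarith [sq_nonneg (σ - u)]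
    calc μ i * (lam i k * (r i * (σ + u))) ^ 2
        = (lam i k * r i) * (μ i * r i * lam i k * (σ + u) ^ 2) := by ring
      _ ≤ γ * (μ i * r i * lam i k * (2 * σ ^ 2 + 2 * u ^ 2)) := by gcongr
  have h2 : μ i * lam i k ≤ 1 := by
    calc μ i * lam i k ≤ 1 * 1 :=
          mul_le_mul (le_one_of_sum_eq_one hμ hμ1 i) (hl.trans hγ) hl0.le one_pos.le
      _ = 1 := mul_one 1
  have h3 : μ i * lam i k * (γ * (2 * (r i * u ^ 2))) ≤ 1 * (γ * (2 * (r i * u ^ 2))) := by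
    gcongr
  linarith

/-- With `t = σ + u`, the bound `2 (σ + u) σ ≥ (3/2) σ² - 2 u²` holds because the difference is
`(1/2) (σ + 2u)²`. -/
lemma le_dotProduct_wmean_gainStep {μ r : Fin N → ℝ} (hμ : ∀ i, 0 < μ i) (hμ1 : ∑ i, μ i = 1)
    (hr : ∀ i, 0 < r i) {lam : Matrix (Fin N) (Fin d) ℝ} {γ : ℝ}
    (hlam : ∀ i k, 0 < lam i k ∧ lam i k ≤ γ) (t : Matrix (Fin N) (Fin d) ℝ) :
    3 / 2 * dissip μ r lam t - 2 * γ * wsq r (dev r t) ≤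
      2 * (wmean μ (gainStep r lam t) ⬝ᵥ wmean r t) := by
  have hw : ∀ k, wmean μ (gainStep r lam t) k * wmean r t k =
      ∑ i, μ i * gainStep r lam t i k * wmean r t k := fun k => Finset.sum_mul _ _ _
  simp only [wsq, dissip, dotProduct, hw, Finset.mul_sum, ← Finset.sum_sub_distrib]
  refine Finset.sum_le_sum fun k _ => Finset.sum_le_sum fun i _ => ?_
  simp only [gainStep, Matrix.of_apply]
  have htk := eq_wmean_add_dev r t i k
  set σ := wmean r t k
  set u := dev r t i k
  rw [htk]
  obtain ⟨hl0, hl⟩ := hlam i k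
  have hμi := hμ i
  have hri := hr i
  have h1 : 0 ≤ μ i * r i * lam i k * (1 / 2 * (σ + 2 * u) ^ 2) := by positivity
  have h2 : μ i * lam i k ≤ γ := by
    calc μ i * lam i k ≤ 1 * γ :=
          mul_le_mul (le_one_of_sum_eq_one hμ hμ1 i) hl hl0.le one_pos.le
      _ = γ := one_mul γ
  have h3 : μ i * lam i k * (2 * (r i * u ^ 2)) ≤ γ * (2 * (r i * u ^ 2)) := by
    gcongr
  linarith

lemma two_mul_dotProduct_le {n : Type*} [Fintype n] (v w : n → ℝ) :
    2 * (v ⬝ᵥ w) ≤ v ⬝ᵥ v + w ⬝ᵥ w := by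
  have h := dotProduct_self_nonneg' (v - w)
  rw [sub_dotProduct, dotProduct_sub, dotProduct_sub, dotProduct_comm w v] at h
  linarith

/-- For small gains, the Lyapunov function decreases uniformly along the error dynamics. -/
theorem exists_lyap_decrease {G : SimpleGraph (Fin N)} (hG : G.Connected)
    {A B : Matrix (Fin N) (Fin N) ℝ} (hA : Matches G A) (hAr : RowStochastic A)
    (hB : Matches G B) (hBr : RowStochastic B) {μ r : Fin N → ℝ}
    (hμ : ∀ i, 0 < μ i) (hμ1 : ∑ i, μ i = 1) (hμA : ∀ j, ∑ i, μ i * A i j = μ j)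
    (hr : ∀ i, 0 < r i) (hr1 : ∑ i, r i = 1) (hrB : ∀ j, ∑ i, r i * B i j = r j)
    {C : Fin N → Matrix (Fin d) (Fin d) ℝ} (hC : ∀ i, (C i).IsSymm) :
    ∃ γ : ℝ, 0 < γ ∧ ∃ α : ℝ, 0 < α ∧ ∃ β : ℝ, 0 < β ∧
      ∀ lam : Matrix (Fin N) (Fin d) ℝ, (∀ i k, 0 < lam i k ∧ lam i k ≤ γ) →
      ∀ x t x' t' : Matrix (Fin N) (Fin d) ℝ, x' = A * x - gainStep r lam t →
        t' = B * t + Matrix.of (fun i => ((r i)⁻¹ • C i) *ᵥ (x' - x) i) →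
        wmean r t = ∑ i, C i *ᵥ x i →
        lyap μ r C α x' t' + (dissip μ r lam t + wsq μ (dev μ x) + β * wsq r (dev r t)) ≤
          lyap μ r C α x t := by
  obtain ⟨c₁, hc₁, hcA⟩ := exists_contraction hG hA hAr hμ hμA
  obtain ⟨c₂, hc₂, hcB⟩ := exists_contraction hG hB hBr hr hrB
  obtain ⟨K₁, hK₁, hKC⟩ := exists_sum_rowwise_sq_le hμ C
  obtain ⟨K₂, hK₂, hKv⟩ := exists_wsq_rowwise_le r hμ hr fun i => (r i)⁻¹ • C i
  obtain ⟨K₃, hK₃, hKS⟩ := exists_mulVec_sq_le (∑ i, C i)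
  obtain ⟨c, hc, hcle₁, hcle₂, hc1⟩ : ∃ c : ℝ, 0 < c ∧ c ≤ c₁ ∧ c ≤ c₂ ∧ c ≤ 1 :=
    ⟨min (min c₁ c₂) 1, by positivity, (min_le_left _ _).trans (min_le_left _ _),
      (min_le_left _ _).trans (min_le_right _ _), min_le_right _ _⟩
  set b : ℝ := 1 + c⁻¹ with hb
  have hb0 : 0 < b := by positivity
  -- The gain `α c² X` must pay for `K₁ X` in the average cost and `8 b K₂ X` in the tracking error,
  -- and leave one `X` over.
  set α : ℝ := (K₁ + 8 * (b * K₂) + 1) / c ^ 2 with hα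
  have hα0 : 0 < α := by positivity
  have hαc : α * c ^ 2 = K₁ + 8 * (b * K₂) + 1 := by
    rw [hα]; field_simp
  -- `M` collects all coefficients of `H`, the squared step: from the average cost, the consensus
  -- error and the tracking error.
  set M : ℝ := (K₃ + 2) + α * b + 2 * (b * K₂) with hM
  have hM0 : 0 < M := by positivity
  -- With this choice `M H + 2 γ U ≤ (c²/2)(q + U)`. This leaves `q` out of `(3/2) q`, since `c ≤
  -- 1`, and `(c²/2) U` out of `c² U`.
  set γ : ℝ := c ^ 2 / (2 * (2 * M + 2)) with hγ
  have hγ0 : 0 < γ := by positivity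
  have hγM : γ * (2 * M + 2) = c ^ 2 / 2 := by
    rw [hγ]; field_simp
  have hcsq : c ^ 2 ≤ 1 := pow_le_one₀ hc.le hc1
  have hγ1 : γ ≤ 1 := by
    have : γ * 1 ≤ γ * (2 * M + 2) := by gcongr; linarith
    linarith
  refine ⟨γ, hγ0, α, hα0, c ^ 2 / 2, by positivity, ?_⟩
  intro lam hlam x t x' t' hx' ht' hσ
  set h := gainStep r lam t with hh
  set X := wsq μ (dev μ x) with hX
  set U := wsq r (dev r t) with hU
  set q := dissip μ r lam t with hq
  set H := wsq μ h with hHdef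
  have hX0 : 0 ≤ X := wsq_nonneg hμ _
  have hU0 : 0 ≤ U := wsq_nonneg hr _
  have hq0 : 0 ≤ q := dissip_nonneg hμ hr (fun i k => (hlam i k).1) t
  have hH : H ≤ 2 * γ * (q + U) := wsq_gainStep_le hμ hμ1 hr hr1 hγ1 hlam t
  have hH0 : 0 ≤ H := wsq_nonneg hμ _
  have hcc : (1 + c) * (1 - c) = 1 - c ^ 2 := by ring
  have contrX : wsq μ (A * dev μ x) ≤ (1 - c) * X :=
    (wsq_mul_dev_le hcA hμ1 x).trans (mul_le_mul_of_nonneg_right (by linarith) hX0)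
  have contrU : wsq r (B * dev r t) ≤ (1 - c) * U :=
    (wsq_mul_dev_le hcB hr1 t).trans (mul_le_mul_of_nonneg_right (by linarith) hU0)
  -- consensus error
  have stepX : wsq μ (dev μ x') ≤ (1 - c ^ 2) * X + b * H := by
    rw [hx', dev_sub, dev_mul hAr hμA]
    refine (wsq_sub_le hμ hc _ _).trans ?_
    rw [← hcc, mul_assoc]
    exact add_le_add (mul_le_mul_of_nonneg_left contrX (by positivity))
      (mul_le_mul_of_nonneg_left (wsq_dev_le hμ1 h) hb0.le)
  -- increment of the state
  have stepD : wsq μ (x' - x) ≤ 8 * X + 2 * H := by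
    -- Two uses of Young with `τ = 1`: `‖A ξ - ξ‖² ≤ 4 X`, then `2 · 4 X + 2 H`.
    have e : x' - x = (A * dev μ x - dev μ x) - h := by
      rw [hx', ← mul_sub_self_eq_dev hAr]; abel
    have h1 := wsq_sub_le hμ one_pos (A * dev μ x) (dev μ x)
    have h2 := wsq_sub_le hμ one_pos (A * dev μ x - dev μ x) h
    have h3 : wsq μ (A * dev μ x) ≤ X := wsq_mul_le hA hAr hμ hμA _
    rw [e]
    norm_num at h1 h2
    linarith
  -- tracking error
  have stepU : wsq r (dev r t') ≤ (1 - c ^ 2) * U + b * (K₂ * (8 * X + 2 * H)) := by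
    rw [ht', dev_add, dev_mul hBr hrB]
    refine (wsq_add_le hr hc _ _).trans ?_
    rw [← hcc, mul_assoc]
    exact add_le_add (mul_le_mul_of_nonneg_left contrU (by positivity))
      (mul_le_mul_of_nonneg_left ((wsq_dev_le hr1 _).trans ((hKv _).trans
        (mul_le_mul_of_nonneg_left stepD hK₂))) hb0.le)
  -- cost at the average
  set S := ∑ i, C i with hS
  set e := wmean μ x with he
  set η := wmean μ h with hη
  have hSsymm : Sᵀ = S := by
    rw [hS, Matrix.transpose_sum]
    exact Finset.sum_congr rfl fun i _ => hC i
  have he' : wmean μ x' = e - η := by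
    rw [hx', wmean_sub, wmean_mul hμA]
  -- The mean tracker is the total gradient at the mean point, up to disagreement. Only here does
  -- the zero-sum condition on `z` enter, through `hσ`.
  have hSe : S *ᵥ e = wmean r t - ∑ i, C i *ᵥ dev μ x i := by
    rw [hσ, ← Finset.sum_sub_distrib, hS, Matrix.sum_mulVec]
    refine Finset.sum_congr rfl fun i _ => ?_
    rw [← Matrix.mulVec_sub]
    congr 1
    funext k
    simp [dev, he]
  have hexp : (e - η) ⬝ᵥ (S *ᵥ (e - η)) =
      e ⬝ᵥ (S *ᵥ e) - 2 * (η ⬝ᵥ (S *ᵥ e)) + η ⬝ᵥ (S *ᵥ η) := by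
    have hs : e ⬝ᵥ (S *ᵥ η) = η ⬝ᵥ (S *ᵥ e) := by
      rw [Matrix.dotProduct_mulVec, ← Matrix.mulVec_transpose, hSsymm, dotProduct_comm]
    rw [Matrix.mulVec_sub, sub_dotProduct, dotProduct_sub, dotProduct_sub, hs]
    ring
  have hηH : η ⬝ᵥ η ≤ H := wmean_sq_le hμ hμ1 h
  have hηS : η ⬝ᵥ (S *ᵥ η) ≤ (K₃ + 1) * H := by
    have h1 := two_mul_dotProduct_le η (S *ᵥ η)
    have h2 := hKS η
    have h3 : K₃ * (η ⬝ᵥ η) ≤ K₃ * H := mul_le_mul_of_nonneg_left hηH hK₃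
    have h4 : 0 ≤ K₃ * H := by positivity
    linarith
  have hησ : 3 / 2 * q - 2 * γ * U ≤ 2 * (η ⬝ᵥ wmean r t) :=
    le_dotProduct_wmean_gainStep hμ hμ1 hr hlam t
  have hηξ : 2 * (η ⬝ᵥ ∑ i, C i *ᵥ dev μ x i) ≤ H + K₁ * X :=
    (two_mul_dotProduct_le _ _).trans (add_le_add hηH (hKC _))
  have stepE : wmean μ x' ⬝ᵥ (S *ᵥ wmean μ x') ≤
      e ⬝ᵥ (S *ᵥ e) - 3 / 2 * q + 2 * γ * U + K₁ * X + (K₃ + 2) * H := by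
    rw [he', hexp, hSe, dotProduct_sub, dotProduct_sub]
    linarith
  have hMH : M * H ≤ M * (2 * γ * (q + U)) := mul_le_mul_of_nonneg_left hH hM0.le
  have hαX := mul_le_mul_of_nonneg_left stepX hα0.le
  have hfin : M * (2 * γ * (q + U)) + 2 * γ * U ≤ c ^ 2 / 2 * q + c ^ 2 / 2 * U := by
    rw [← hγM]
    have : 0 ≤ γ * q := by positivity
    linarith
  have hq1 : c ^ 2 * q ≤ q := mul_le_of_le_one_left hq0 hcsq
  have hαX2 : α * c ^ 2 * X = (K₁ + 8 * (b * K₂) + 1) * X := by rw [hαc]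
  have hMH2 : M * H = (K₃ + 2) * H + α * b * H + 2 * (b * K₂) * H := by rw [hM]; ring
  simp only [lyap]
  linarith

end

/-! ### Convergence of the error dynamics -/

section

variable {N d : ℕ}

/-- The rows `C i * x i`. -/
def rowGrad (C : Fin N → Matrix (Fin d) (Fin d) ℝ) (x : Matrix (Fin N) (Fin d) ℝ) :
    Matrix (Fin N) (Fin d) ℝ :=
  Matrix.of fun i => C i *ᵥ x i

lemma tendsto_zero_of_mul_sq_le {a : ℝ} (ha : 0 < a) {f D : ℕ → ℝ} (hD : Tendsto D atTop (𝓝 0))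
    (h : ∀ n, a * f n ^ 2 ≤ D n) : Tendsto f atTop (𝓝 0) := by
  have h1 : Tendsto (fun n => a⁻¹ * D n) atTop (𝓝 0) := by simpa using hD.const_mul a⁻¹
  have h2 : Tendsto (fun n => f n ^ 2) atTop (𝓝 0) := by
    refine squeeze_zero (fun n => sq_nonneg _) (fun n => ?_) h1
    rw [inv_mul_eq_div, le_div_iff₀ ha, mul_comm]
    exact h n
  have h3 := h2.sqrt
  simp only [Real.sqrt_sq_eq_abs, Real.sqrt_zero] at h3
  exact (tendsto_zero_iff_abs_tendsto_zero f).2 h3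

/-- Telescoping bounds the partial sums of `D` by `V 0`, so `D` is summable. -/
lemma tendsto_zero_of_add_le {V D : ℕ → ℝ} (hV : ∀ n, 0 ≤ V n) (hD : ∀ n, 0 ≤ D n)
    (h : ∀ n, V (n + 1) + D n ≤ V n) : Tendsto D atTop (𝓝 0) := by
  refine (summable_of_sum_range_le (c := V 0) hD fun n => ?_).tendsto_atTop_zero
  have : ∑ m ∈ Finset.range n, D m + V n ≤ V 0 := by
    induction n with
    | zero => simp
    | succ n ih =>
      rw [Finset.sum_range_succ]
      linarith [h n]
  linarith [hV n]

lemma le_wsq {μ : Fin N → ℝ} (hμ : ∀ i, 0 < μ i) (x : Matrix (Fin N) (Fin d) ℝ) (i : Fin N)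
    (k : Fin d) : μ i * x i k ^ 2 ≤ wsq μ x := by
  have h : ∀ i k, 0 ≤ μ i * x i k ^ 2 := fun i k => mul_nonneg (hμ i).le (sq_nonneg _)
  exact (Finset.single_le_sum (f := fun i => μ i * x i k ^ 2) (fun i _ => h i k)
    (Finset.mem_univ i)).trans (Finset.single_le_sum (f := fun k => ∑ i, μ i * x i k ^ 2)
    (fun k _ => Finset.sum_nonneg fun i _ => h i k) (Finset.mem_univ k))

lemma le_dissip {μ r : Fin N → ℝ} (hμ : ∀ i, 0 < μ i) (hr : ∀ i, 0 < r i)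
    {lam : Matrix (Fin N) (Fin d) ℝ} (hlam : ∀ i k, 0 < lam i k) (t : Matrix (Fin N) (Fin d) ℝ)
    (i : Fin N) (k : Fin d) : μ i * r i * lam i k * wmean r t k ^ 2 ≤ dissip μ r lam t := by
  have h : ∀ i k, 0 ≤ μ i * r i * lam i k * wmean r t k ^ 2 := fun i k =>
    mul_nonneg (mul_pos (mul_pos (hμ i) (hr i)) (hlam i k)).le (sq_nonneg _)
  exact (Finset.single_le_sum (f := fun i => μ i * r i * lam i k * wmean r t k ^ 2)
    (fun i _ => h i k) (Finset.mem_univ i)).trans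
    (Finset.single_le_sum (f := fun k => ∑ i, μ i * r i * lam i k * wmean r t k ^ 2)
    (fun k _ => Finset.sum_nonneg fun i _ => h i k) (Finset.mem_univ k))

lemma posDef_sum [Nonempty (Fin N)] {C : Fin N → Matrix (Fin d) (Fin d) ℝ}
    (hC : ∀ i, (C i).PosDef) : (∑ i, C i).PosDef :=
  Matrix.posDef_sum Finset.univ_nonempty fun i _ => hC i

lemma matches_transpose {G : SimpleGraph (Fin N)} {A : Matrix (Fin N) (Fin N) ℝ}
    (hA : Matches G A) : Matches G Aᵀ := by
  intro i j
  have := hA j i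
  rwa [G.adj_comm, eq_comm] at this

/-- A column stochastic matrix is, up to a diagonal scaling, row stochastic with a stationary
distribution. -/
theorem exists_scaling {G : SimpleGraph (Fin N)} (hG : G.Connected)
    {At : Matrix (Fin N) (Fin N) ℝ} (hAt : Matches G At) (hAtc : ColStochastic At) :
    ∃ (r : Fin N → ℝ) (B : Matrix (Fin N) (Fin N) ℝ), (∀ i, 0 < r i) ∧ ∑ i, r i = 1 ∧
      Matches G B ∧ RowStochastic B ∧ (∀ j, ∑ i, r i * B i j = r j) ∧
      ∀ i j, r i * B i j = At i j * r j := by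
  have hrow : RowStochastic Atᵀ := by
    rw [RowStochastic, Matrix.mulVec_transpose]
    exact hAtc
  obtain ⟨r, hr, hr1, hrA⟩ := exists_stationary hG (matches_transpose hAt) hrow
  have hB : ∀ i j, r i * (At i j * r j / r i) = At i j * r j := fun i j =>
    mul_div_cancel₀ _ (hr i).ne'
  -- `B = R⁻¹ Ã R` with `R = diag r`: its rows sum to one because `Ã r = r`, and `r` is stationary
  -- because the columns of `Ã` sum to one.
  refine ⟨r, Matrix.of fun i j => At i j * r j / r i, hr, hr1, fun i j => ⟨fun h => ?_, fun h => ?_⟩,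
    ?_, fun j => ?_, hB⟩
  · exact div_pos (mul_pos ((hAt i j).1 h) (hr j)) (hr i)
  · simp [(hAt i j).2 h]
  · funext i
    simp only [Matrix.mulVec, dotProduct, Matrix.of_apply, mul_one]
    rw [← Finset.sum_div, div_eq_one_iff_eq (hr i).ne']
    simpa [mul_comm] using hrA i
  · simp only [Matrix.of_apply, hB]
    rw [← Finset.sum_mul]
    have := hrow.sum_row j
    simp only [Matrix.transpose_apply] at this
    rw [this, one_mul]

/-- For small gains, the gradient-tracking error dynamics converge to zero from every initial
condition whose tracking variables sum to zero. -/
theorem exists_error_tendsto_zero {G : SimpleGraph (Fin N)} (hG : G.Connected)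
    {A At : Matrix (Fin N) (Fin N) ℝ} (hA : Matches G A) (hAr : RowStochastic A)
    (hAt : Matches G At) (hAtc : ColStochastic At)
    {C : Fin N → Matrix (Fin d) (Fin d) ℝ} (hC : ∀ i, (C i).PosDef) :
    ∃ γ : ℝ, 0 < γ ∧ ∀ lam : Matrix (Fin N) (Fin d) ℝ, (∀ i k, 0 < lam i k ∧ lam i k ≤ γ) →
      ∀ x z : ℕ → Matrix (Fin N) (Fin d) ℝ,
        (∀ n i k, x (n + 1) i k =
          (A * x n) i k - lam i k * (z n + rowGrad C (x n)) i k) →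
        (∀ n, z (n + 1) = At * (z n + rowGrad C (x n)) - rowGrad C (x n)) →
        (∀ k, ∑ i, z 0 i k = 0) →
        (∀ i k, Tendsto (fun n => x n i k) atTop (𝓝 0)) ∧
          ∀ i k, Tendsto (fun n => z n i k) atTop (𝓝 0) := by
  have hne := hG.nonempty
  obtain ⟨μ, hμ, hμ1, hμA⟩ := exists_stationary hG hA hAr
  obtain ⟨r, B, hr, hr1, hB, hBr, hrB, hrBA⟩ := exists_scaling hG hAt hAtc
  have hSpos := posDef_sum hC
  obtain ⟨γ, hγ, α, hα, β, hβ, hstep⟩ := exists_lyap_decrease hG hA hAr hB hBr hμ hμ1 hμA hr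
    hr1 hrB fun i =>
      (Matrix.conjTranspose_eq_transpose_of_trivial (C i)).symm.trans (hC i).isHermitian
  refine ⟨γ, hγ, fun lam hlam x z hx hz hz0 => ?_⟩
  -- The tracker `s = z + C x`, rescaled by `r`.
  set t : ℕ → Matrix (Fin N) (Fin d) ℝ :=
    fun n => Matrix.of fun i k => (r i)⁻¹ * (z n + rowGrad C (x n)) i k with ht
  have hrt : ∀ n i k, r i * t n i k = (z n + rowGrad C (x n)) i k := fun n i k =>
    mul_inv_cancel_left₀ (hr i).ne' _
  have hzsum : ∀ n k, ∑ i, z n i k = 0 := by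
    intro n
    induction n with
    | zero => exact hz0
    | succ n ih =>
      intro k
      have hcol : ∀ j, ∑ i, At i j = 1 := fun j => by
        simpa [Matrix.vecMul, dotProduct] using congrFun hAtc j
      simp only [hz, Matrix.sub_apply, Finset.sum_sub_distrib, Matrix.mul_apply]
      rw [Finset.sum_comm]
      simp only [← Finset.sum_mul, hcol, one_mul, Matrix.add_apply, Finset.sum_add_distrib, ih k]
      ring
  have hσ : ∀ n, wmean r (t n) = ∑ i, C i *ᵥ x n i := by
    intro n
    funext k
    simp only [wmean, hrt, Matrix.add_apply, Finset.sum_add_distrib, hzsum, zero_add,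
      Finset.sum_apply]
    rfl
  have hxs : ∀ n, x (n + 1) = A * x n - gainStep r lam (t n) := by
    intro n
    ext i k
    simp only [Matrix.sub_apply, gainStep, Matrix.of_apply, hrt, hx]
  have hts : ∀ n, t (n + 1) =
      B * t n + Matrix.of (fun i => ((r i)⁻¹ • C i) *ᵥ (x (n + 1) - x n) i) := by
    intro n
    ext i k
    refine mul_left_cancel₀ (hr i).ne' ?_
    have h1 : r i * (B * t n) i k = (At * (z n + rowGrad C (x n))) i k := by
      simp only [Matrix.mul_apply, Finset.mul_sum, ← mul_assoc, hrBA]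
      exact Finset.sum_congr rfl fun j _ => by rw [mul_assoc, hrt]
    have h2 : (x (n + 1) - x n) i = x (n + 1) i - x n i := rfl
    rw [hrt, hz, Matrix.add_apply, Matrix.add_apply (B * t n), mul_add, h1]
    simp only [Matrix.of_apply, Matrix.smul_mulVec, Pi.smul_apply, smul_eq_mul, h2,
      Matrix.mulVec_sub, Pi.sub_apply, rowGrad, Matrix.sub_apply]
    rw [mul_inv_cancel_left₀ (hr i).ne']
    ring
  set D : ℕ → ℝ := fun n =>
    dissip μ r lam (t n) + wsq μ (dev μ (x n)) + β * wsq r (dev r (t n)) with hDdef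
  have hq0 : ∀ n, 0 ≤ dissip μ r lam (t n) := fun n =>
    dissip_nonneg hμ hr (fun i k => (hlam i k).1) _
  have hX0 : ∀ n, 0 ≤ wsq μ (dev μ (x n)) := fun n => wsq_nonneg hμ _
  have hU0 : ∀ n, 0 ≤ β * wsq r (dev r (t n)) := fun n => mul_nonneg hβ.le (wsq_nonneg hr _)
  have hD : Tendsto D atTop (𝓝 0) := by
    refine tendsto_zero_of_add_le (V := fun n => lyap μ r C α (x n) (t n)) (fun n => ?_)
      (fun n => add_nonneg (add_nonneg (hq0 n) (hX0 n)) (hU0 n))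
      (fun n => hstep lam hlam _ _ _ _ (hxs n) (hts n) (hσ n))
    refine add_nonneg (add_nonneg ?_ (mul_nonneg hα.le (hX0 n))) (wsq_nonneg hr _)
    simpa using hSpos.posSemidef.dotProduct_mulVec_nonneg (wmean μ (x n))
  have hσ0 : ∀ k, Tendsto (fun n => wmean r (t n) k) atTop (𝓝 0) := by
    intro k
    obtain ⟨i⟩ := hne
    refine tendsto_zero_of_mul_sq_le (mul_pos (mul_pos (hμ i) (hr i)) (hlam i k).1) hD fun n => ?_
    have := le_dissip hμ hr (fun i k => (hlam i k).1) (t n) i k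
    have h1 := hX0 n
    have h2 := hU0 n
    simp only [hDdef]
    linarith
  have hξ0 : ∀ i k, Tendsto (fun n => dev μ (x n) i k) atTop (𝓝 0) := by
    intro i k
    refine tendsto_zero_of_mul_sq_le (hμ i) hD fun n => ?_
    have := le_wsq hμ (dev μ (x n)) i k
    have h1 := hq0 n
    have h2 := hU0 n
    simp only [hDdef]
    linarith
  have hu0 : ∀ i k, Tendsto (fun n => dev r (t n) i k) atTop (𝓝 0) := by
    intro i k
    refine tendsto_zero_of_mul_sq_le (mul_pos hβ (hr i)) hD fun n => ?_
    have := mul_le_mul_of_nonneg_left (le_wsq hr (dev r (t n)) i k) hβ.le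
    have h1 := hq0 n
    have h2 := hX0 n
    simp only [hDdef]
    linarith
  have hmulVec : ∀ (M : Matrix (Fin d) (Fin d) ℝ) (v : ℕ → Fin d → ℝ),
      Tendsto v atTop (𝓝 0) → Tendsto (fun n => M *ᵥ v n) atTop (𝓝 0) := by
    intro M v hv
    have hc : Continuous fun w : Fin d → ℝ => M *ᵥ w :=
      Continuous.matrix_mulVec continuous_const continuous_id
    have h := (hc.tendsto 0).comp hv
    rwa [Matrix.mulVec_zero] at h
  -- The dissipation controls `σ`, not `e`; the mean is recovered from `S e = σ - ∑ C_i ξ_i`, with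
  -- `ξ` the disagreement, by inverting `S`.
  have he0 : Tendsto (fun n => wmean μ (x n)) atTop (𝓝 0) := by
    have h1 : Tendsto (fun n => wmean r (t n) - ∑ i, C i *ᵥ dev μ (x n) i) atTop (𝓝 0) := by
      have ha : Tendsto (fun n => wmean r (t n)) atTop (𝓝 0) := tendsto_pi_nhds.2 hσ0
      have hb : Tendsto (fun n => ∑ i, C i *ᵥ dev μ (x n) i) atTop (𝓝 (∑ _i : Fin N, 0)) :=
        tendsto_finsetSum _ fun i _ => hmulVec (C i) _ (tendsto_pi_nhds.2 (hξ0 i))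
      simpa using ha.sub hb
    have h2 := hmulVec (∑ i, C i)⁻¹ _ h1
    refine h2.congr fun n => ?_
    have h3 : wmean r (t n) - ∑ i, C i *ᵥ dev μ (x n) i = (∑ i, C i) *ᵥ wmean μ (x n) := by
      rw [hσ, ← Finset.sum_sub_distrib, Matrix.sum_mulVec]
      refine Finset.sum_congr rfl fun i _ => ?_
      rw [← Matrix.mulVec_sub]
      congr 1
      funext k
      simp [dev]
    rw [h3, Matrix.mulVec_mulVec, Matrix.nonsing_inv_mul _ hSpos.det_pos.ne'.isUnit,
      Matrix.one_mulVec]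
  have hx0 : ∀ i k, Tendsto (fun n => x n i k) atTop (𝓝 0) := by
    intro i k
    have := ((tendsto_pi_nhds.1 he0) k).add (hξ0 i k)
    simp only [Pi.zero_apply, add_zero] at this
    exact this.congr fun n => (eq_wmean_add_dev μ (x n) i k).symm
  refine ⟨hx0, fun i k => ?_⟩
  have h1 : Tendsto (fun n => r i * t n i k) atTop (𝓝 0) := by
    have := ((hσ0 k).add (hu0 i k)).const_mul (r i)
    simp only [add_zero, mul_zero] at this
    exact this.congr fun n => by rw [eq_wmean_add_dev r (t n) i k]
  have h2 : Tendsto (fun n => (C i *ᵥ x n i) k) atTop (𝓝 0) :=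
    tendsto_pi_nhds.1 (hmulVec (C i) _ (tendsto_pi_nhds.2 (hx0 i))) k
  have h3 := h1.sub h2
  rw [sub_zero] at h3
  refine h3.congr fun n => ?_
  rw [hrt]
  simp [rowGrad]

end

/-! ### The closed loop -/

section

variable {N d p : ℕ}

lemma lift_mulVec (A : Matrix (Fin N) (Fin N) ℝ) (v : Fin N × Fin d → ℝ) (i : Fin N) (k : Fin d) :
    (lift d A *ᵥ v) (i, k) = (A * Matrix.of fun i k => v (i, k)) i k := by
  simp [lift, Matrix.mulVec, dotProduct, Matrix.mul_apply, Fintype.sum_prod_type,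
    Matrix.kroneckerMap_apply, Matrix.one_apply]

lemma stackC_mulVec (C : Fin N → Matrix (Fin d) (Fin d) ℝ) (v : Fin N × Fin d → ℝ) (i : Fin N)
    (k : Fin d) : (stackC C *ᵥ v) (i, k) = rowGrad C (Matrix.of fun i k => v (i, k)) i k := by
  simp only [stackC, Matrix.mulVec, dotProduct, Matrix.of_apply, Fintype.sum_prod_type, ite_mul,
    zero_mul, rowGrad]
  rw [Finset.sum_eq_single i]
  · simp
  · intro j _ hj
    simp [hj.symm]
  · simp

lemma consensus_mulVec (v : Fin d → ℝ) (i : Fin N) (k : Fin d) :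
    (consensus N d *ᵥ v) (i, k) = v k := by
  simp [consensus, Matrix.mulVec, dotProduct]

lemma lift_mul_consensus {A : Matrix (Fin N) (Fin N) ℝ} (hA : RowStochastic A) :
    lift d A * consensus N d = consensus N d := by
  ext ⟨i, k⟩ l
  have h := lift_mulVec A (fun a => consensus N d a l) i k
  change (lift d A *ᵥ fun a => consensus N d a l) (i, k) = _
  rw [h]
  simp only [Matrix.mul_apply, consensus, Matrix.of_apply]
  by_cases hkl : k = l <;> simp [hkl, hA.sum_row]

/-- The closed-loop matrix acting on a state `(x, z)`. -/
lemma gtController_F_mulVec (A At : Matrix (Fin N) (Fin N) ℝ)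
    (C : Fin N → Matrix (Fin d) (Fin d) ℝ) (l : Fin N × Fin d → ℝ) (y : Idx N d d → ℝ) :
    (∀ i k, ((gtController d A At (-diagonal l) (-diagonal l)).F C *ᵥ y) (Sum.inl (i, k)) =
      (A * Matrix.of fun i k => y (Sum.inl (i, k))) i k - l (i, k) *
        ((Matrix.of fun i k => y (Sum.inr (i, k))) +
          rowGrad C (Matrix.of fun i k => y (Sum.inl (i, k)))) i k) ∧
    (∀ i k, ((gtController d A At (-diagonal l) (-diagonal l)).F C *ᵥ y) (Sum.inr (i, k)) =
      (At * ((Matrix.of fun i k => y (Sum.inr (i, k))) +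
          rowGrad C (Matrix.of fun i k => y (Sum.inl (i, k)))) -
        rowGrad C (Matrix.of fun i k => y (Sum.inl (i, k)))) i k) := by
  refine ⟨fun i k => ?_, fun i k => ?_⟩
  · simp only [Controller.F, gtController, Matrix.fromBlocks_mulVec, Sum.elim_inl,
      Matrix.add_mulVec, ← Matrix.mulVec_mulVec, Matrix.neg_mulVec, Matrix.mulVec_diagonal,
      Pi.add_apply, Pi.neg_apply, lift_mulVec, stackC_mulVec, Matrix.add_apply, Matrix.of_apply,
      Function.comp_apply]
    ring
  · simp only [Controller.F, gtController, Matrix.fromBlocks_mulVec, Sum.elim_inr, zero_add,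
      Matrix.sub_mulVec, Matrix.one_mulVec, ← Matrix.mulVec_mulVec,
      Pi.add_apply, Pi.sub_apply, lift_mulVec, stackC_mulVec, Matrix.sub_apply, Matrix.mul_add,
      Matrix.add_apply, Function.comp_apply]
    have : (Matrix.of fun i k => rowGrad C (Matrix.of fun i k => y (Sum.inl (i, k))) i k) =
      rowGrad C (Matrix.of fun i k => y (Sum.inl (i, k))) := rfl
    rw [this]
    ring

/-- The functional summing the `k`-th coordinates of the controller states. -/
def sumFunctional (N : ℕ) {d : ℕ} (k : Fin d) : Idx N d d → ℝ :=
  Sum.elim 0 fun a => if a.2 = k then 1 else 0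

lemma sumFunctional_dotProduct (k : Fin d) (y : Idx N d d → ℝ) :
    sumFunctional N k ⬝ᵥ y = ∑ i, y (Sum.inr (i, k)) := by
  simp [sumFunctional, dotProduct, Fintype.sum_sum_type, Fintype.sum_prod_type]

/-- Summing over agents is invariant under `Ã` and annihilates `(Ã - I) C`. -/
lemma sumFunctional_vecMul_F {A At : Matrix (Fin N) (Fin N) ℝ} (hAtc : ColStochastic At)
    (C : Fin N → Matrix (Fin d) (Fin d) ℝ) (k : Fin d) :
    sumFunctional N k ᵥ* (gtController d A At 0 0).F C = sumFunctional N k := by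
  have h : (fun a : Fin N × Fin d => if a.2 = k then (1 : ℝ) else 0) ᵥ* lift d At =
      fun a => if a.2 = k then 1 else 0 := by
    have hcol : ∀ j, ∑ i, At i j = 1 := fun j => by
      simpa [Matrix.vecMul, dotProduct] using congrFun hAtc j
    funext ⟨j, l⟩
    simp only [lift, Matrix.vecMul, dotProduct, Fintype.sum_prod_type, Matrix.kroneckerMap_apply,
      Matrix.one_apply, ite_mul, one_mul, zero_mul, Finset.sum_ite_eq', Finset.mem_univ, if_true]
    by_cases hkl : k = l
    · simp [hkl, hcol]
    · simp [hkl, Ne.symm hkl]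
  rw [sumFunctional, Controller.F, Matrix.vecMul_fromBlocks]
  have h0 : (fun _ : Fin N × Fin d => (0 : ℝ)) ᵥ* lift d A = 0 := Matrix.zero_vecMul _
  simp [gtController, ← Matrix.vecMul_vecMul, Matrix.vecMul_sub, h, h0, Function.comp_def]

lemma sumFunctional_mem_orthCompl {A At : Matrix (Fin N) (Fin N) ℝ} (hAtc : ColStochastic At)
    (C : Fin N → Matrix (Fin d) (Fin d) ℝ) (k : Fin d) :
    sumFunctional N k ∈ orthCompl (gtSubspace A At C) := by
  have hpow : ∀ n : ℕ, sumFunctional N k ᵥ* ((gtController d A At 0 0).F C) ^ n =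
      sumFunctional N k := by
    intro n
    induction n with
    | zero => simp
    | succ n ih => rw [pow_succ, ← Matrix.vecMul_vecMul, ih, sumFunctional_vecMul_F hAtc]
  intro v hv
  have hle : gtSubspace A At C ≤
      LinearMap.ker (dotProductBilin ℝ ℝ (sumFunctional N k : Idx N d d → ℝ)) := by
    refine iSup_le fun n => ?_
    rintro _ ⟨u, rfl⟩
    simp only [LinearMap.mem_ker, dotProductBilin_apply_apply, Matrix.mulVecLin_apply]
    rw [Matrix.dotProduct_mulVec, ← Matrix.vecMul_vecMul, hpow, sumFunctional,
      Matrix.vecMul_fromRows]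
    simp
  simpa using hle hv

/-- Orthogonal projection onto `V^⊥`, carried out in `EuclideanSpace` because the function type
carries the sup norm. -/
lemma exists_mem_orthCompl_sub_mem {ι : Type*} [Fintype ι] (V : Submodule ℝ (ι → ℝ))
    (w : ι → ℝ) : ∃ q ∈ orthCompl V, w - q ∈ V := by
  set e := (WithLp.linearEquiv 2 ℝ (ι → ℝ)).symm with he
  obtain ⟨y, hy, z, hz, hyz⟩ :=
    (V.map (e : (ι → ℝ) →ₗ[ℝ] EuclideanSpace ℝ ι)).exists_add_mem_mem_orthogonal (e w)
  obtain ⟨v, hv, rfl⟩ := hy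
  refine ⟨e.symm z, fun u hu => ?_, ?_⟩
  · have := (Submodule.mem_orthogonal _ _).1 hz (e u) ⟨u, hu, rfl⟩
    simpa [EuclideanSpace.inner_eq_star_dotProduct, he] using this
  · have : w = v + e.symm z := e.injective (by simpa using hyz)
    rw [this, add_sub_cancel_right]
    exact hv

/-- Project each column of `Π` onto `V^⊥`; the columns of `Π - P` then lie in `V`. -/
lemma exists_bias {ι : Type*} [Fintype ι] (V : Submodule ℝ (ι → ℝ)) (Pi : Matrix ι (Fin p) ℝ) :
    ∃ P : Matrix ι (Fin p) ℝ, (∀ θ, P *ᵥ θ ∈ orthCompl V) ∧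
      ∀ u ∈ orthCompl V, u ᵥ* (Pi - P) = 0 := by
  choose q hq hqV using fun j => exists_mem_orthCompl_sub_mem V fun a => Pi a j
  refine ⟨Matrix.of fun a j => q j a, fun θ v hv => ?_, fun u hu => ?_⟩
  · rw [dotProduct_comm, Matrix.dotProduct_mulVec]
    have : v ᵥ* (Matrix.of fun a j => q j a) = 0 := by
      funext j
      exact (dotProduct_comm _ _).trans (hq j v hv)
    rw [this, zero_dotProduct]
  · funext j
    exact hu _ (hqV j)

/-- The steady state of the closed loop solves the regulator equations. -/
lemma exists_steady_state {A At : Matrix (Fin N) (Fin N) ℝ} (hA : RowStochastic A)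
    (C : Fin N → Matrix (Fin d) (Fin d) ℝ) (Γ : Fin N → Matrix (Fin d) (Fin p) ℝ)
    (K : Matrix (Fin N × Fin d) (Fin N × Fin d) ℝ) :
    ∃ Pi : Matrix (Idx N d d) (Fin p) ℝ,
      Pi = (gtController d A At K K).F C * Pi + (gtController d A At K K).G C Γ ∧
      Pi.toRows₁ = consensus N d * optMap C Γ := by
  -- The `z` block is minus the local gradients, so `z + y = 0`: equal gains `Kz = Ky` contribute
  -- nothing, and consensus is fixed by `A`.
  refine ⟨Matrix.fromRows (consensus N d * optMap C Γ)
    (-(stackC C * (consensus N d * optMap C Γ) + stackQ C Γ)), ?_, Matrix.toRows₁_fromRows _ _⟩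
  have h : lift d A * (consensus N d * optMap C Γ) = consensus N d * optMap C Γ := by
    rw [← Matrix.mul_assoc, lift_mul_consensus hA]
  have hadd : ∀ (a c : Matrix (Fin N × Fin d) (Fin p) ℝ) (b e : Matrix (Fin N × Fin d) (Fin p) ℝ),
      Matrix.fromRows a b + Matrix.fromRows c e = Matrix.fromRows (a + c) (b + e) := by
    intro a c b e
    ext (i | i) j <;> rfl
  rw [Controller.F, Controller.G, Matrix.fromBlocks_mul_fromRows, hadd]
  simp only [gtController]
  congr 1
  · rw [Matrix.add_mul, h]
    simp only [Matrix.mul_neg, Matrix.mul_add, Matrix.mul_assoc]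
    abel
  · simp only [Matrix.mul_neg, Matrix.mul_add, Matrix.add_mul, Matrix.sub_mul, Matrix.mul_assoc,
      Matrix.one_mul, Matrix.zero_mul]
    abel

/-- Gradient tracking with small diagonal gains solves the set-point control problem. -/
theorem exists_gtSolves_diagonal {G : SimpleGraph (Fin N)} (hG : G.Connected)
    {A At : Matrix (Fin N) (Fin N) ℝ} (hA : Matches G A) (hAr : RowStochastic A)
    (hAt : Matches G At) (hAtc : ColStochastic At)
    {C : Fin N → Matrix (Fin d) (Fin d) ℝ} (hC : ∀ i, (C i).PosDef) :
    ∃ γ : ℝ, 0 < γ ∧ ∀ l : Fin N × Fin d → ℝ, (∀ a, 0 < l a ∧ l a ≤ γ) →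
      ∀ (p : ℕ) (Γ : Fin N → Matrix (Fin d) (Fin p) ℝ), GTSolves A At C Γ (-diagonal l) := by
  obtain ⟨γ, hγ, hconv⟩ := exists_error_tendsto_zero hG hA hAr hAt hAtc hC
  refine ⟨γ, hγ, fun l hl p Γ => ⟨?_, ?_⟩⟩
  · obtain ⟨Pi, hPi, hPi₁⟩ := exists_steady_state (At := At) hAr C Γ (-diagonal l)
    obtain ⟨P, hP, hPiP⟩ := exists_bias (gtSubspace A At C) Pi
    exact ⟨P, hP, Pi, hPi, hPi₁, hPiP⟩
  rintro P ⟨-, Pi, hPi, hPi₁, hPiP⟩ θ₀ w hw ⟨v, hv, hw0⟩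
  set F := (gtController d A At (-diagonal l) (-diagonal l)).F C with hF
  set y : ℕ → Idx N d d → ℝ := fun n => w n - Pi *ᵥ θ₀ with hy
  have hys : ∀ n, y (n + 1) = F *ᵥ y n := by
    intro n
    have h1 : Pi *ᵥ θ₀ = F *ᵥ (Pi *ᵥ θ₀) +
        (gtController d A At (-diagonal l) (-diagonal l)).G C Γ *ᵥ θ₀ := by
      rw [Matrix.mulVec_mulVec, ← Matrix.add_mulVec, ← hPi]
    simp only [hy, Matrix.mulVec_sub, hw n]
    nth_rewrite 1 [h1]
    abel
  -- `y 0 = v - (Π - P) θ₀`, and both terms are annihilated by the sum functional because it lies in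
  -- `V^⊥`.
  have hy0 : ∀ k, ∑ i, y 0 (Sum.inr (i, k)) = 0 := by
    intro k
    have hmem := sumFunctional_mem_orthCompl (A := A) hAtc C k
    have h1 : y 0 = v - (Pi - P) *ᵥ θ₀ := by
      simp only [hy, hw0, Matrix.sub_mulVec]
      abel
    rw [← sumFunctional_dotProduct, h1, dotProduct_sub, hmem v hv, Matrix.dotProduct_mulVec,
      hPiP _ hmem, zero_dotProduct, sub_zero]
  obtain ⟨hx, hz⟩ := hconv (Matrix.of fun i k => l (i, k)) (fun i k => hl (i, k))
    (fun n => Matrix.of fun i k => y n (Sum.inl (i, k)))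
    (fun n => Matrix.of fun i k => y n (Sum.inr (i, k)))
    (fun n i k => by
      rw [Matrix.of_apply, hys]
      exact (gtController_F_mulVec A At C l (y n)).1 i k)
    (fun n => by
      ext i k
      rw [Matrix.of_apply, hys]
      exact (gtController_F_mulVec A At C l (y n)).2 i k)
    hy0
  have hlim : Tendsto w atTop (𝓝 (Pi *ᵥ θ₀)) := by
    have h0 : Tendsto y atTop (𝓝 0) := by
      refine tendsto_pi_nhds.2 ?_
      rintro (⟨i, k⟩ | ⟨i, k⟩)
      · exact hx i k
      · exact hz i k
    have := h0.add_const (Pi *ᵥ θ₀)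
    rw [zero_add] at this
    exact this.congr fun n => sub_add_cancel _ _
  refine ⟨Metric.isBounded_range_of_tendsto w hlim, fun i => tendsto_pi_nhds.2 fun k => ?_⟩
  have h1 := (tendsto_pi_nhds.1 hlim) (Sum.inl (i, k))
  have h2 : (Pi *ᵥ θ₀) (Sum.inl (i, k)) = (optMap C Γ *ᵥ θ₀) k := by
    rw [← consensus_mulVec (N := N) (optMap C Γ *ᵥ θ₀) i k, Matrix.mulVec_mulVec, ← hPi₁]
    rfl
  rwa [h2] at h1

end

end GradientTracking

theorem proposition3 {N d : ℕ} (G : SimpleGraph (Fin N)) (hG : G.Connected)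
    (A At : Matrix (Fin N) (Fin N) ℝ)
    (hA : GradientTracking.Matches G A) (hAr : GradientTracking.RowStochastic A)
    (hAt : GradientTracking.Matches G At) (hAtc : GradientTracking.ColStochastic At)
    (C : Fin N → Matrix (Fin d) (Fin d) ℝ) (hC : ∀ i, (C i).PosDef) :
    ∃ γstar : ℝ, 0 < γstar ∧
      ∀ (p : ℕ) (Γ : Fin N → Matrix (Fin d) (Fin p) ℝ),
        (∀ Λ : Matrix (Fin N × Fin d) (Fin N × Fin d) ℝ, Λ.IsDiag → Λ.PosDef →
          spectrum ℝ Λ ⊆ Set.Ioo 0 γstar → GradientTracking.GTSolves A At C Γ (-Λ)) ∧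
        (∀ γ : ℝ, 0 < γ → γ < γstar →
          GradientTracking.GTSolves A At C Γ
            (-(γ • (1 : Matrix (Fin N × Fin d) (Fin N × Fin d) ℝ)))) := by
  obtain ⟨γ, hγ, h⟩ := GradientTracking.exists_gtSolves_diagonal hG hA hAr hAt hAtc hC
  refine ⟨γ, hγ, fun p Γ => ⟨fun Λ hdiag hpos hspec => ?_, fun g hg0 hg => ?_⟩⟩
  · rw [← hdiag.diagonal_diag, spectrum_diagonal] at hspec
    rw [← hdiag.diagonal_diag]
    refine h _ (fun a => ?_) p Γ
    have := hspec (Set.mem_range_self a)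
    exact ⟨this.1, this.2.le⟩
  · rw [Matrix.smul_one_eq_diagonal]
    exact h _ (fun _ => ⟨hg0, hg.le⟩) p Γ
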